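/- Let $n>4$. For a measurable potential $V:\mathbb{R}^n\to\mathbb{C}$ in $L^1_{loc}(\mathbb{R}^n)$ let $|V|-\Delta$ denote the operator on $L^2(\mathbb{R}^n)$ (complex-valued functions) associated with the form $$\mathfrak{l}[u,v]=\int_{\mathbb{R}^n}\langle\nabla u,\nabla v\rangle\,dx+\int_{\mathbb{R}^n}|V|\,u\,\overline{v}\,dx,\qquad u,v\in H^{1,V}:=\{u\in H^1(\mathbb{R}^n): |V|^{1/2}u\in L^2(\mathbb{R}^n)\},$$ that is, $u\in D(|V|-\Delta)$ and $(|V|-\Delta)u=w\in L^2(\mathbb{R}^n)$ if and only if $u\in H^{1,V}$ and $\mathfrak{l}[u,v]=\langle w,v\rangle_2$ for all $v\in H^{1,V}$; the operator $-\Delta$ is the case $V=0$. Let $\mathcal{W}_2$ be the class of all $V\in L^1_{loc}(\mathbb{R}^n)$ for which there is a constant $C$ (depending on $V$) such that every $u\in D(|V|-\Delta)$ satisfies $|V|u\in L^2(\mathbb{R}^n)$, $u\in D(-\Delta)$ and $$\||V|u\|_2+\|\Delta u\|_2\le C\,\|(|V|-\Delta)u\|_2 .$$ Then $$L^{n/2}(\mathbb{R}^n)\subset\mathcal{W}_2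 .$$ -/

import Mathlib

open MeasureTheory
open scoped ENNReal SchwartzMap LineDeriv

/-- The complex Hilbert space `L²(ℝⁿ)`. -/
abbrev L2 (n : ℕ) : Type :=
  Lp ℂ 2 (volume : Measure (EuclideanSpace ℝ (Fin n)))

/-- `u ∈ H¹(ℝⁿ)` with gradient `(g 1, …, g n) ∈ L²(ℝⁿ; ℂⁿ)`: for every `i`, the distributional
derivative of `u ∈ L²` in the `i`-th coordinate direction is the `L²` function `g i`. -/
def HasWeakGradient {n : ℕ} (u : L2 n) (g : Fin n → L2 n) : Prop :=
  ∀ i : Fin n,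
    ∂_{EuclideanSpace.single i (1 : ℝ)} (u : 𝓢'(EuclideanSpace ℝ (Fin n), ℂ)) =
      (g i : 𝓢'(EuclideanSpace ℝ (Fin n), ℂ))

/-- `u ∈ D(q^{1/2})`, i.e. `q^{1/2} u ∈ L²(ℝⁿ)`, for a potential `q ≥ 0`. -/
def MemSqrtDomain {n : ℕ} (q : EuclideanSpace ℝ (Fin n) → ℝ) (u : L2 n) : Prop :=
  MemLp (fun x => (Real.sqrt (q x) : ℂ) * u x) 2 volume

/-- The graph of the operator `q - Δ` on `L²(ℝⁿ)`, for a potential `q ≥ 0`, defined by the form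
`𝔩[u, v] = ∫ ⟨∇u, ∇v⟩ + ∫ q u v̄` with form domain `{u ∈ H¹(ℝⁿ) : q^{1/2} u ∈ L²(ℝⁿ)}`.
`IsSchrodinger q u w` says that `u ∈ D(q - Δ)` and `(q - Δ) u = w`: `u` lies in the form domain
and `𝔩[u, v] = ⟨w, v⟩` for all `v` in the form domain. Mathlib's `inner ℂ` is conjugate-linear in
its first argument, so `⟨a, b⟩ = ∫ a b̄` is `inner ℂ b a`. -/
def IsSchrodinger {n : ℕ} (q : EuclideanSpace ℝ (Fin n) → ℝ) (u w : L2 n) : Prop :=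
  ∃ g : Fin n → L2 n, HasWeakGradient u g ∧ MemSqrtDomain q u ∧
    ∀ (v : L2 n) (h : Fin n → L2 n), HasWeakGradient v h → MemSqrtDomain q v →
      ∑ i, inner ℂ (h i) (g i) + ∫ x, (q x : ℂ) * u x * (starRingEnd ℂ) (v x) = inner ℂ v w

/-- The class `𝒲₂` of all `V ∈ L¹_loc(ℝⁿ)` such that the supremum of
`(‖|V| u‖₂ + ‖-Δ u‖₂) / ‖(|V| - Δ) u‖₂` over `u ∈ D(|V| - Δ)` is finite. Here `-Δ` is the operator
`q - Δ` with `q = 0`; finiteness of the supremum includes that every `u ∈ D(|V| - Δ)` lies in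
`D(|V|)` (there is an `L²` function `z = |V| u`) and in `D(-Δ)` (there is `f = -Δ u`). -/
def potentialClassW2 (n : ℕ) : Set (EuclideanSpace ℝ (Fin n) → ℂ) :=
  {V | LocallyIntegrable V volume ∧
    ∃ C : ℝ, ∀ u w : L2 n, IsSchrodinger (fun x => ‖V x‖) u w →
      ∃ z f : L2 n,
        (∀ᵐ x, z x = (‖V x‖ : ℂ) * u x) ∧
        IsSchrodinger (fun _ => 0) u f ∧
        ‖z‖ + ‖f‖ ≤ C * ‖w‖}

/-! By Hölder, `2/n + (n-4)/(2n) = 1/2` reduces the bound on `|V|u` to an estimate `‖u‖_{2n/(n-4)} ≤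
C ‖(q - Δ)u‖₂` with `C` independent of the potential `q ≥ 0` (`IsSchrodinger.eLpNorm_le`). Once
`|V|u` is in `L²`, `-Δu = w - |V|u`: Sobolev makes the form domain of `|V| - Δ` all of `H¹`, so both
forms have the same test functions.

The uniform estimate comes from a nonlinear test function. Let `ρ(t) = min(|t|, M)^a` with `a =
2/(n-4)`, and let `P`, `Φ` be the primitives of `ρ`, `ρ²`. Testing with `Φ(re u)` gives `‖∇P(re
u)‖₂² ≤ ‖Φ(re u)‖₂ ‖w‖₂`, since `tΦ(t) ≥ 0` lets the potential term be dropped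
(`IsSchrodinger.energy_le`). Put `X = ‖(re u) ρ(re u)‖_{2n/(n-2)}` and `θ = n/(n-2)`. Sobolev and
`|t|ρ ≲ |P|` bound `X` by the gradient norm, while `|Φ| ≤ (|t|ρ)^θ` gives `‖Φ(re u)‖₂ ≤ X^θ`. Hence
`X² ≤ K X^θ ‖w‖₂`; solve for `X`, let `M → ∞`, and treat `im u` by replacing `u` with `-iu`.

The chain rule and the Sobolev inequality on `H¹` rest on the density of Schwartz functions
(`HasWeakGradient.exists_tendsto_schwartz`). -/

open Filter Topology
open scoped NNReal

/-! ### Weak gradients as distributional derivatives -/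

/-- The `i`-th coordinate vector of `ℝⁿ`. -/
noncomputable abbrev coordVec {n : ℕ} (i : Fin n) : EuclideanSpace ℝ (Fin n) := EuclideanSpace.single i (1 : ℝ)

/-- The `i`-th partial derivative of a Schwartz function. -/
noncomputable abbrev partialSchwartz {n : ℕ} (i : Fin n)
    (φ : 𝓢(EuclideanSpace ℝ (Fin n), ℂ)) : 𝓢(EuclideanSpace ℝ (Fin n), ℂ) :=
  ∂_{coordVec i} φ

theorem hasWeakGradient_iff_integral {n : ℕ} {u : L2 n} {g : Fin n → L2 n} :
    HasWeakGradient u g ↔ ∀ (i : Fin n) (ψ : 𝓢(EuclideanSpace ℝ (Fin n), ℂ)),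
      ∫ x, (partialSchwartz i ψ) x * u x = -∫ x, ψ x * g i x := by
  unfold HasWeakGradient
  refine forall_congr' fun i => ?_
  rw [DFunLike.ext_iff]
  refine forall_congr' fun ψ => ?_
  rw [TemperedDistribution.lineDerivOp_apply_apply, Lp.toTemperedDistribution_apply,
    Lp.toTemperedDistribution_apply]
  have e : ∀ x, (-∂_{EuclideanSpace.single i (1 : ℝ)} ψ) x • u x =
      -((partialSchwartz i ψ) x * u x) := fun x => by rw [neg_apply, neg_smul, smul_eq_mul]
  simp only [e, integral_neg, smul_eq_mul]
  exact neg_eq_iff_eq_neg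

theorem HasWeakGradient.sub {n : ℕ} {u v : L2 n} {g h : Fin n → L2 n}
    (hu : HasWeakGradient u g) (hv : HasWeakGradient v h) :
    HasWeakGradient (u - v) (fun i => g i - h i) := by
  intro i
  have h1 := hu i
  have h2 := hv i
  simp only [← Lp.toTemperedDistributionCLM_apply] at h1 h2 ⊢
  rw [map_sub, map_sub, ← h1, ← h2, sub_eq_add_neg, sub_eq_add_neg,
    LineDeriv.lineDerivOp_add, LineDeriv.lineDerivOp_neg]

theorem HasWeakGradient.const_smul {n : ℕ} {u : L2 n} {g : Fin n → L2 n}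
    (hu : HasWeakGradient u g) (c : ℂ) : HasWeakGradient (c • u) (fun i => c • g i) := by
  intro i
  have h1 := hu i
  simp only [← Lp.toTemperedDistributionCLM_apply] at h1 ⊢
  rw [map_smul, map_smul, ← h1, LineDeriv.lineDerivOp_smul]

theorem hasWeakGradient_schwartz {n : ℕ} (φ : 𝓢(EuclideanSpace ℝ (Fin n), ℂ)) :
    HasWeakGradient (φ.toLp 2 volume) (fun i => (partialSchwartz i φ).toLp 2 volume) := by
  intro i
  rw [Lp.toTemperedDistribution_toLp_eq, Lp.toTemperedDistribution_toLp_eq,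
    TemperedDistribution.lineDerivOp_toTemperedDistributionCLM_eq]

/-- The weak gradient is a closed operator. -/
theorem HasWeakGradient.of_tendsto {n : ℕ} {u : L2 n} {g : Fin n → L2 n} {U : ℕ → L2 n}
    {G : ℕ → Fin n → L2 n} (h : ∀ k, HasWeakGradient (U k) (G k))
    (hU : Tendsto U atTop (𝓝 u)) (hG : ∀ i, Tendsto (fun k => G k i) atTop (𝓝 (g i))) :
    HasWeakGradient u g := by
  intro i
  have h1 := ((Lp.toTemperedDistributionCLM ℂ
    (volume : Measure (EuclideanSpace ℝ (Fin n))) 2).continuous.tendsto u).comp hU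
  have h2 := ((Lp.toTemperedDistributionCLM ℂ
    (volume : Measure (EuclideanSpace ℝ (Fin n))) 2).continuous.tendsto (g i)).comp (hG i)
  have h3 := ((LineDeriv.lineDerivOpCLM ℂ 𝓢'(EuclideanSpace ℝ (Fin n), ℂ)
    (coordVec i)).continuous.tendsto _).comp h1
  refine tendsto_nhds_unique h3 (h2.congr fun k => ?_)
  exact (h k i).symm

/-! ### Density of Schwartz functions in `H¹` -/

open scoped Laplacian in
-- The symbol is `1 + |ξ|²`, and `Δ` has symbol `-(2π)²|ξ|²`. This fixes the weight `(2π)⁻²` on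
-- gradients in the `H¹` inner product used below.
theorem besselPotential_two_eq {n : ℕ} (T : 𝓢'(EuclideanSpace ℝ (Fin n), ℂ)) :
    TemperedDistribution.besselPotential (EuclideanSpace ℝ (Fin n)) ℂ 2 T =
      T - ((2 * Real.pi) ^ 2)⁻¹ • Δ T := by
  have h1 : (Function.HasTemperateGrowth
      (fun _ : EuclideanSpace ℝ (Fin n) => (1 : ℂ))) := by fun_prop
  have h2 : (Function.HasTemperateGrowth
      (fun x : EuclideanSpace ℝ (Fin n) => Complex.ofReal (‖x‖ ^ 2))) := by fun_prop
  -- The symbol is split as a sum over `Bool` so that additivity of Fourier multipliers applies.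
  have key := TemperedDistribution.fourierMultiplierCLM_sum (E := EuclideanSpace ℝ (Fin n)) ℂ
    (s := Finset.univ)
    (g := fun b : Bool => if b then (fun _ => (1 : ℂ)) else fun x => Complex.ofReal (‖x‖ ^ 2))
    (by rintro (_ | _) _ <;> simpa only [Bool.false_eq_true, if_false, if_true])
  have e : TemperedDistribution.besselPotential (EuclideanSpace ℝ (Fin n)) ℂ 2 =
      TemperedDistribution.fourierMultiplierCLM ℂ (fun x : EuclideanSpace ℝ (Fin n) =>
        ∑ b : Bool, (if b then (fun _ => (1 : ℂ)) else fun x => Complex.ofReal (‖x‖ ^ 2)) x) := by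
    unfold TemperedDistribution.besselPotential
    congr 1
    ext x
    simp
  rw [e, key, TemperedDistribution.laplacian_eq_fourierMultiplierCLM]
  simp only [Fintype.sum_bool, if_true, Bool.false_eq_true, if_false, add_apply,
    TemperedDistribution.fourierMultiplierCLM_const, one_smul, ContinuousLinearMap.id_apply]
  rw [smul_smul, show ((2 * Real.pi) ^ 2)⁻¹ * -(2 * Real.pi) ^ 2 = (-1 : ℝ) by
    field_simp [Real.pi_ne_zero], neg_one_smul, sub_neg_eq_add]

/-- The pointwise complex conjugate of a Schwartz function. -/
noncomputable def conjSchwartz {n : ℕ} (φ : 𝓢(EuclideanSpace ℝ (Fin n), ℂ)) :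
    𝓢(EuclideanSpace ℝ (Fin n), ℂ) :=
  SchwartzMap.postcompCLM (𝕜 := ℝ) (Complex.conjCLE : ℂ →L[ℝ] ℂ) φ

theorem lineDerivOp_conjSchwartz {n : ℕ} (φ : 𝓢(EuclideanSpace ℝ (Fin n), ℂ))
    (m x : EuclideanSpace ℝ (Fin n)) :
    (∂_{m} (conjSchwartz φ)) x = starRingEnd ℂ ((∂_{m} φ) x) := by
  rw [SchwartzMap.lineDerivOp_apply_eq_fderiv, SchwartzMap.lineDerivOp_apply_eq_fderiv]
  have h := ((Complex.conjCLE : ℂ →L[ℝ] ℂ).hasFDerivAt.comp x (φ.hasFDerivAt x)).fderiv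
  have e : (⇑(conjSchwartz φ)) = (⇑(Complex.conjCLE : ℂ →L[ℝ] ℂ)) ∘ ⇑φ := rfl
  rw [e, h]
  rfl

/-- Conjugating the test function converts the sesquilinear inner product into the bilinear
distributional pairing. -/
theorem inner_toLp_conjSchwartz {n : ℕ} (φ ψ : 𝓢(EuclideanSpace ℝ (Fin n), ℂ)) (u : L2 n)
    (h : ∀ x, φ x = starRingEnd ℂ (ψ x)) :
    inner ℂ (φ.toLp 2 volume) u = (u : 𝓢'(EuclideanSpace ℝ (Fin n), ℂ)) ψ := by
  rw [L2.inner_def, Lp.toTemperedDistribution_apply]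
  refine integral_congr_ae ?_
  filter_upwards [φ.coeFn_toLp 2 volume] with x hx
  rw [hx, RCLike.inner_apply, h, Complex.conj_conj, smul_eq_mul, mul_comm]

theorem Lp.toTemperedDistribution_injective {n : ℕ} {u v : L2 n}
    (h : (u : 𝓢'(EuclideanSpace ℝ (Fin n), ℂ)) = v) : u = v := by
  have hk := Lp.ker_toTemperedDistributionCLM_eq_bot (F := ℂ) (p := 2)
    (μ := (volume : Measure (EuclideanSpace ℝ (Fin n))))
  exact LinearMap.ker_eq_bot.1 hk h

open scoped Laplacian in
/-- A pair `(u, ∇u)` orthogonal to all Schwartz pairs in a suitable `H¹` inner product vanishes. -/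
theorem HasWeakGradient.eq_zero_of_orthogonal {n : ℕ} {u : L2 n} {g : Fin n → L2 n}
    (hu : HasWeakGradient u g)
    (h : ∀ φ : 𝓢(EuclideanSpace ℝ (Fin n), ℂ), inner ℂ (φ.toLp 2 volume) u +
      (((2 * Real.pi) ^ 2)⁻¹ : ℝ) • ∑ i, inner ℂ ((partialSchwartz i φ).toLp 2 volume) (g i) = 0) :
    u = 0 ∧ ∀ i, g i = 0 := by
  have h0 : TemperedDistribution.besselPotential (EuclideanSpace ℝ (Fin n)) ℂ 2
      (u : 𝓢'(EuclideanSpace ℝ (Fin n), ℂ)) = 0 := by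
    rw [besselPotential_two_eq]
    ext ψ
    have h1 := h (conjSchwartz ψ)
    rw [inner_toLp_conjSchwartz _ ψ _ (fun x => rfl)] at h1
    have h2 : ∀ i, inner ℂ ((partialSchwartz i (conjSchwartz ψ)).toLp 2 volume) (g i) =
        - (∂_{coordVec i} (∂_{coordVec i} (u : 𝓢'(EuclideanSpace ℝ (Fin n), ℂ)))) ψ := by
      intro i
      rw [inner_toLp_conjSchwartz _ (partialSchwartz i ψ) _
        (fun x => lineDerivOp_conjSchwartz ψ _ x), hu i,
        TemperedDistribution.lineDerivOp_apply_apply, map_neg, neg_neg]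
    rw [Finset.sum_congr rfl fun i _ => h2 i] at h1
    rw [TemperedDistribution.laplacian_eq_sum (EuclideanSpace.basisFun (Fin n) ℝ)]
    simp only [EuclideanSpace.basisFun_apply]
    rw [Finset.sum_neg_distrib, smul_neg, ← sub_eq_add_neg] at h1
    refine Eq.trans ?_ h1
    simp only [sub_apply, smul_apply,
      sum_apply]
  -- The Bessel potential of order `-2` inverts the one of order `2`, already on tempered
  -- distributions.
  have h1 : (u : 𝓢'(EuclideanSpace ℝ (Fin n), ℂ)) = 0 := by
    have := congrArg
      (TemperedDistribution.besselPotential (EuclideanSpace ℝ (Fin n)) ℂ (-2)) h0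
    simpa using this
  have z : ((0 : L2 n) : 𝓢'(EuclideanSpace ℝ (Fin n), ℂ)) = 0 := by
    rw [← Lp.toTemperedDistributionCLM_apply, map_zero]
  refine ⟨Lp.toTemperedDistribution_injective (h1.trans z.symm), fun i => ?_⟩
  refine Lp.toTemperedDistribution_injective ?_
  rw [← hu i, h1, z, LineDeriv.lineDerivOp_zero]

/-- The `H¹` pair `(φ, (2π)⁻¹ ∇φ)` of a Schwartz function. -/
noncomputable def schwartzGraph (n : ℕ) :
    𝓢(EuclideanSpace ℝ (Fin n), ℂ) →ₗ[ℂ] PiLp 2 (fun _ : Option (Fin n) => L2 n) where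
  toFun φ := WithLp.toLp 2 fun o => o.elim (φ.toLp 2 volume)
    fun i => ((2 * Real.pi)⁻¹ : ℂ) • (partialSchwartz i φ).toLp 2 volume
  map_add' φ ψ := by
    ext1 o
    cases o with
    | none => exact map_add (SchwartzMap.toLpCLM ℂ ℂ 2 volume) φ ψ
    | some i =>
      simp only [Option.elim_some, PiLp.add_apply, ← smul_add, partialSchwartz, LineDeriv.lineDerivOp_add]
      congr 1
  map_smul' c φ := by
    ext1 o
    cases o with
    | none => exact map_smul (SchwartzMap.toLpCLM ℂ ℂ 2 volume) c φ
    | some i =>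
      simp only [Option.elim_some, PiLp.smul_apply, RingHom.id_apply, partialSchwartz, LineDeriv.lineDerivOp_smul]
      rw [smul_comm]
      congr 1

/-- Project `(u, ∇u)` onto the closure of the Schwartz pairs. The weak gradient is closed, so the
residual is again a function with its weak gradient; being orthogonal to every Schwartz pair, it
vanishes. -/
theorem HasWeakGradient.exists_tendsto_schwartz {n : ℕ} {u : L2 n} {g : Fin n → L2 n}
    (hu : HasWeakGradient u g) :
    ∃ φ : ℕ → 𝓢(EuclideanSpace ℝ (Fin n), ℂ),
      Tendsto (fun k => (φ k).toLp 2 volume) atTop (𝓝 u) ∧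
      ∀ i, Tendsto (fun k => (partialSchwartz i (φ k)).toLp 2 volume) atTop (𝓝 (g i)) := by
  have hpi : (2 * Real.pi : ℂ) ≠ 0 := by
    simp [Real.pi_ne_zero]
  have lim : ∀ {x : PiLp 2 (fun _ : Option (Fin n) => L2 n)},
      x ∈ (LinearMap.range (schwartzGraph n)).topologicalClosure →
      ∃ φ : ℕ → 𝓢(EuclideanSpace ℝ (Fin n), ℂ),
        Tendsto (fun k => (φ k).toLp 2 volume) atTop (𝓝 (x none)) ∧
        ∀ i, Tendsto (fun k => (partialSchwartz i (φ k)).toLp 2 volume) atTop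
          (𝓝 ((2 * Real.pi : ℂ) • x (some i))) := by
    intro x hx
    obtain ⟨s, hs, hl⟩ := mem_closure_iff_seq_limit.1 hx
    choose φ hφ using fun k => LinearMap.mem_range.1 (hs k)
    have hc : ∀ o, Tendsto (fun k => s k o) atTop (𝓝 (x o)) := fun o =>
      ((PiLp.continuous_apply 2 _ o).tendsto x).comp hl
    refine ⟨φ, (hc none).congr fun k => ?_, fun i =>
      ((hc (some i)).const_smul (2 * Real.pi : ℂ)).congr fun k => ?_⟩
    · rw [← hφ k]; rfl
    · rw [← hφ k]
      change (2 * Real.pi : ℂ) • (((2 * Real.pi)⁻¹ : ℂ) • (partialSchwartz i (φ k)).toLp 2 volume) = _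
      rw [smul_smul, mul_inv_cancel₀ hpi, one_smul]
  set x : PiLp 2 (fun _ : Option (Fin n) => L2 n) := WithLp.toLp 2 fun o => o.elim u
    fun i => ((2 * Real.pi)⁻¹ : ℂ) • g i with hx
  set K := (LinearMap.range (schwartzGraph n)).topologicalClosure with hK
  have : CompleteSpace K :=
    (Submodule.isClosed_topologicalClosure _).completeSpace_coe
  obtain ⟨p, hp, hr⟩ := Submodule.HasOrthogonalProjection.exists_orthogonal (K := K) x
  obtain ⟨ψ, hψ, hψ'⟩ := lim hp
  have hpg : HasWeakGradient (p none) (fun i => (2 * Real.pi : ℂ) • p (some i)) :=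
    HasWeakGradient.of_tendsto (fun k => hasWeakGradient_schwartz (ψ k)) hψ hψ'
  have hd := hu.sub hpg
  have := hd.eq_zero_of_orthogonal (fun φ => by
    have h1 := (Submodule.mem_orthogonal _ _).1 hr (schwartzGraph n φ)
      (Submodule.le_topologicalClosure _ (LinearMap.mem_range_self _ φ))
    rw [PiLp.inner_apply, Fintype.sum_option] at h1
    refine Eq.trans ?_ h1
    congr 1
    rw [Finset.smul_sum]
    refine Finset.sum_congr rfl fun i _ => ?_
    change _ = inner ℂ (((2 * Real.pi)⁻¹ : ℂ) • (partialSchwartz i φ).toLp 2 volume)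
      (((2 * Real.pi)⁻¹ : ℂ) • g i - p (some i))
    have e : g i - (2 * Real.pi : ℂ) • p (some i) =
        (2 * Real.pi : ℂ) • (((2 * Real.pi)⁻¹ : ℂ) • g i - p (some i)) := by
      rw [smul_sub, smul_smul, mul_inv_cancel₀ hpi, one_smul]
    rw [e, inner_smul_left, inner_smul_right, Complex.real_smul, ← mul_assoc]
    congr 1
    have : (starRingEnd ℂ) ((2 * Real.pi)⁻¹ : ℂ) = (2 * Real.pi : ℂ)⁻¹ := by
      rw [map_inv₀, map_mul, Complex.conj_ofReal, Complex.conj_ofNat]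
    rw [this]
    push_cast
    field_simp)
  obtain ⟨ha, hb⟩ := this
  refine ⟨ψ, ?_, fun i => ?_⟩
  · rw [sub_eq_zero.1 ha]; exact hψ
  · rw [sub_eq_zero.1 (hb i)]; exact hψ' i

/-! ### Chain rule for `C¹` maps with bounded derivative -/

section ChainRule

variable {n : ℕ} {F : ℂ → ℂ} {C : ℝ≥0}

theorem aestronglyMeasurable_fderiv_apply (hF : ContDiff ℝ 1 F) (u k : L2 n) :
    AEStronglyMeasurable (fun x => fderiv ℝ F (u x) (k x)) volume :=
  (((hF.continuous_fderiv one_ne_zero).comp continuous_fst).clm_apply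
      continuous_snd : Continuous fun p : ℂ × ℂ => fderiv ℝ F p.1 p.2).comp_aestronglyMeasurable
    ((Lp.aestronglyMeasurable u).prodMk (Lp.aestronglyMeasurable k))

theorem norm_fderiv_apply_le (hC : ∀ z, ‖fderiv ℝ F z‖₊ ≤ C) (z w : ℂ) :
    ‖fderiv ℝ F z w‖ ≤ C * ‖w‖ :=
  (ContinuousLinearMap.le_opNorm _ _).trans
    (mul_le_mul_of_nonneg_right (by exact_mod_cast hC z) (norm_nonneg _))

theorem memLp_fderiv_apply (hF : ContDiff ℝ 1 F) (hC : ∀ z, ‖fderiv ℝ F z‖₊ ≤ C) (u k : L2 n) :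
    MemLp (fun x => fderiv ℝ F (u x) (k x)) 2 volume :=
  (Lp.memLp k).of_le_mul (aestronglyMeasurable_fderiv_apply hF u k)
    (Eventually.of_forall fun _ => norm_fderiv_apply_le hC _ _)

/-- The `L²` function `DF(u)(k)`. -/
noncomputable def fderivLp (hF : ContDiff ℝ 1 F) (hC : ∀ z, ‖fderiv ℝ F z‖₊ ≤ C)
    (u k : L2 n) : L2 n :=
  (memLp_fderiv_apply hF hC u k).toLp _

theorem coeFn_fderivLp (hF : ContDiff ℝ 1 F) (hC : ∀ z, ‖fderiv ℝ F z‖₊ ≤ C) (u k : L2 n) :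
    ∀ᵐ x, fderivLp hF hC u k x = fderiv ℝ F (u x) (k x) :=
  MemLp.coeFn_toLp _

theorem norm_fderivLp_le (hF : ContDiff ℝ 1 F) (hC : ∀ z, ‖fderiv ℝ F z‖₊ ≤ C) (u k : L2 n) :
    ‖fderivLp hF hC u k‖ ≤ C * ‖k‖ := by
  refine Lp.norm_le_mul_norm_of_ae_le_mul ?_
  filter_upwards [coeFn_fderivLp hF hC u k] with x hx
  rw [hx]
  exact norm_fderiv_apply_le hC _ _

theorem fderivLp_sub (hF : ContDiff ℝ 1 F) (hC : ∀ z, ‖fderiv ℝ F z‖₊ ≤ C) (u k l : L2 n) :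
    fderivLp hF hC u (k - l) = fderivLp hF hC u k - fderivLp hF hC u l := by
  ext1
  filter_upwards [coeFn_fderivLp hF hC u (k - l), coeFn_fderivLp hF hC u k,
    coeFn_fderivLp hF hC u l, Lp.coeFn_sub k l,
    Lp.coeFn_sub (fderivLp hF hC u k) (fderivLp hF hC u l)] with x h1 h2 h3 h4 h5
  rw [h1, h5, Pi.sub_apply, h2, h3, h4, Pi.sub_apply, map_sub]

theorem lipschitzWith_of_fderiv_bound (hF : ContDiff ℝ 1 F) (hC : ∀ z, ‖fderiv ℝ F z‖₊ ≤ C) :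
    LipschitzWith C F :=
  lipschitzWith_of_nnnorm_fderiv_le (hF.differentiable one_ne_zero) hC

/-- Here `F ∘ φ` is classically `C¹`, so integration by parts applies. Since `|F z| ≤ C|z|` and
`|DF(z)w| ≤ C|w|`, the integrands are dominated by products of Schwartz functions. -/
theorem hasWeakGradient_comp_schwartz (hF : ContDiff ℝ 1 F) (h0 : F 0 = 0)
    (hC : ∀ z, ‖fderiv ℝ F z‖₊ ≤ C) (φ : 𝓢(EuclideanSpace ℝ (Fin n), ℂ)) :
    HasWeakGradient ((lipschitzWith_of_fderiv_bound hF hC).compLp h0 (φ.toLp 2 volume))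
      (fun i => fderivLp hF hC (φ.toLp 2 volume) ((partialSchwartz i φ).toLp 2 volume)) := by
  rw [hasWeakGradient_iff_integral]
  intro i ψ
  have hlip : ∀ z, ‖F z‖ ≤ C * ‖z‖ := fun z => by
    simpa [h0] using (lipschitzWith_of_fderiv_bound hF hC).dist_le_mul z 0
  have hcF : Continuous fun x => F (φ x) := hF.continuous.comp φ.continuous
  have hcD : Continuous fun x => fderiv ℝ F (φ x) (partialSchwartz i φ x) :=
    ((hF.continuous_fderiv one_ne_zero).comp φ.continuous).clm_apply
      (partialSchwartz i φ).continuous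
  have int1 : ∀ χ : 𝓢(EuclideanSpace ℝ (Fin n), ℂ),
      Integrable (fun x => F (φ x) * χ x) volume := fun χ => by
    refine Integrable.mono'
      ((SchwartzMap.pairing (ContinuousLinearMap.mul ℝ ℂ) φ χ).integrable.norm.const_mul (C : ℝ))
      (hcF.mul χ.continuous).aestronglyMeasurable (Eventually.of_forall fun x => ?_)
    rw [norm_mul]
    change _ ≤ C * ‖φ x * χ x‖
    rw [norm_mul, ← mul_assoc]
    exact mul_le_mul_of_nonneg_right (hlip _) (norm_nonneg _)
  have int2 : Integrable (fun x => fderiv ℝ F (φ x) (partialSchwartz i φ x) * ψ x) volume := by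
    refine Integrable.mono'
      ((SchwartzMap.pairing (ContinuousLinearMap.mul ℝ ℂ)
        (partialSchwartz i φ) ψ).integrable.norm.const_mul (C : ℝ))
      (hcD.mul ψ.continuous).aestronglyMeasurable (Eventually.of_forall fun x => ?_)
    rw [norm_mul]
    change _ ≤ C * ‖partialSchwartz i φ x * ψ x‖
    rw [norm_mul, ← mul_assoc]
    exact mul_le_mul_of_nonneg_right (norm_fderiv_apply_le hC _ _) (norm_nonneg _)
  have key := integral_bilinear_hasLineDerivAt_right_eq_neg_left_of_integrable
    (B := ContinuousLinearMap.mul ℝ ℂ) (f := fun x => F (φ x))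
    (f' := fun x => fderiv ℝ F (φ x) (partialSchwartz i φ x)) (g := ψ)
    (g' := partialSchwartz i ψ) (v := coordVec i) (μ := volume) int2 (int1 _) (int1 _)
    (fun x _ => ((hF.differentiable one_ne_zero (φ x)).hasFDerivAt.comp x
      (φ.hasFDerivAt x)).hasLineDerivAt _)
    (fun x _ => (ψ.hasFDerivAt x).hasLineDerivAt _)
  simp only [ContinuousLinearMap.mul_apply'] at key
  refine (integral_congr_ae ?_).trans (key.trans (congrArg Neg.neg (integral_congr_ae ?_)))
  · filter_upwards [(lipschitzWith_of_fderiv_bound hF hC).coeFn_compLp h0 (φ.toLp 2 volume),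
      φ.coeFn_toLp 2 volume] with x h1 h2
    rw [h1, Function.comp_apply, h2, mul_comm]
  · filter_upwards [coeFn_fderivLp hF hC (φ.toLp 2 volume) ((partialSchwartz i φ).toLp 2 volume),
      φ.coeFn_toLp 2 volume, (partialSchwartz i φ).coeFn_toLp 2 volume] with x h1 h2 h3
    rw [h1, h2, h3, mul_comm]

/-- The chain rule for weak gradients. -/
theorem HasWeakGradient.comp (hF : ContDiff ℝ 1 F) (h0 : F 0 = 0)
    (hC : ∀ z, ‖fderiv ℝ F z‖₊ ≤ C) {u : L2 n} {g : Fin n → L2 n} (hu : HasWeakGradient u g) :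
    HasWeakGradient ((lipschitzWith_of_fderiv_bound hF hC).compLp h0 u)
      (fun i => fderivLp hF hC u (g i)) := by
  obtain ⟨φ₀, hφ₀, hφ₀'⟩ := hu.exists_tendsto_schwartz
  -- Almost everywhere convergence is needed because `DF` is merely continuous.
  obtain ⟨ns, hns, hae⟩ := (tendstoInMeasure_of_tendsto_Lp hφ₀).exists_seq_tendsto_ae
  set φ := fun k => φ₀ (ns k) with hφdef
  have hφ : Tendsto (fun k => (φ k).toLp 2 volume) atTop (𝓝 u) := hφ₀.comp hns.tendsto_atTop
  have hφ' : ∀ i, Tendsto (fun k => (partialSchwartz i (φ k)).toLp 2 volume) atTop (𝓝 (g i)) :=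
    fun i => (hφ₀' i).comp hns.tendsto_atTop
  rw [hasWeakGradient_iff_integral]
  intro i ψ
  have ev : ∀ (f : L2 n) (χ : 𝓢(EuclideanSpace ℝ (Fin n), ℂ)),
      Lp.toTemperedDistributionCLM ℂ volume 2 f χ = ∫ x, χ x * f x := fun f χ => by
    rw [Lp.toTemperedDistributionCLM_apply, Lp.toTemperedDistribution_apply]
    simp only [smul_eq_mul]
  have cont : ∀ χ : 𝓢(EuclideanSpace ℝ (Fin n), ℂ),
      Continuous fun f : L2 n => ∫ x, χ x * f x := fun χ => by
    have := (ContinuousEvalConst.continuous_eval_const (F := 𝓢'(EuclideanSpace ℝ (Fin n), ℂ))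
      χ).comp (Lp.toTemperedDistributionCLM ℂ
        (volume : Measure (EuclideanSpace ℝ (Fin n))) 2).continuous
    exact this.congr fun f => ev f χ
  have lim1 : Tendsto (fun k => ∫ x, (partialSchwartz i ψ) x *
      ((lipschitzWith_of_fderiv_bound hF hC).compLp h0 ((φ k).toLp 2 volume)) x) atTop
      (𝓝 (∫ x, (partialSchwartz i ψ) x *
        ((lipschitzWith_of_fderiv_bound hF hC).compLp h0 u) x)) :=
    ((cont _).tendsto _).comp
      ((((lipschitzWith_of_fderiv_bound hF hC).continuous_compLp h0).tendsto u).comp hφ)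
  -- Split `DF(φ_k)(∂φ_k) = DF(φ_k)(∂φ_k - g) + DF(φ_k)(g)`: the first term tends to zero in `L²`,
  -- the second is handled by dominated convergence.
  have lim2 : Tendsto (fun k => fderivLp hF hC ((φ k).toLp 2 volume)
      ((partialSchwartz i (φ k)).toLp 2 volume - g i)) atTop (𝓝 0) := by
    rw [tendsto_zero_iff_norm_tendsto_zero]
    have h1 : Tendsto (fun k => C * ‖(partialSchwartz i (φ k)).toLp 2 volume - g i‖) atTop
        (𝓝 0) := by
      simpa using (tendsto_iff_norm_sub_tendsto_zero.1 (hφ' i)).const_mul (C : ℝ)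
    exact squeeze_zero (fun k => norm_nonneg _) (fun k => norm_fderivLp_le hF hC _ _) h1
  have lim3 := ((cont ψ).tendsto _).comp lim2
  have lim4 : Tendsto (fun k => ∫ x, ψ x * fderivLp hF hC ((φ k).toLp 2 volume) (g i) x) atTop
      (𝓝 (∫ x, ψ x * fderivLp hF hC u (g i) x)) := by
    have hb : Integrable (fun x => ‖ψ x‖ * (C * ‖g i x‖)) volume := by
      have : Integrable (fun x => ‖g i x‖ * ‖ψ x‖) volume :=
        (Lp.memLp (g i)).norm.integrable_mul (ψ.memLp 2 volume).norm
      exact (this.const_mul (C : ℝ)).congr (Eventually.of_forall fun x => by ring)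
    refine tendsto_integral_of_dominated_convergence _ (fun k =>
      (ψ.continuous.aestronglyMeasurable.mul (Lp.aestronglyMeasurable _))) hb (fun k => ?_) ?_
    · filter_upwards [coeFn_fderivLp hF hC ((φ k).toLp 2 volume) (g i)] with x hx
      rw [hx, norm_mul]
      exact mul_le_mul_of_nonneg_left (norm_fderiv_apply_le hC _ _) (norm_nonneg _)
    · have hall := ae_all_iff.2 fun k => coeFn_fderivLp hF hC ((φ k).toLp 2 volume) (g i)
      filter_upwards [hall, hae, coeFn_fderivLp hF hC u (g i)] with x h1 h2 h3
      rw [h3]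
      simp only [h1]
      refine tendsto_const_nhds.mul ?_
      exact (((hF.continuous_fderiv one_ne_zero).clm_apply
        (continuous_const (y := g i x))).tendsto (u x)).comp h2
  have lim5 := (lim3.add lim4).neg
  have z : ∫ x, ψ x * (0 : L2 n) x = 0 := by
    rw [← ev, map_zero]; rfl
  rw [z, zero_add] at lim5
  refine tendsto_nhds_unique lim1 (lim5.congr fun k => ?_)
  rw [hasWeakGradient_iff_integral.1 (hasWeakGradient_comp_schwartz hF h0 hC (φ k)) i ψ]
  congr 1
  simp only [Function.comp_apply]
  rw [fderivLp_sub, ← ev, ← ev, ← ev, map_sub, sub_apply, sub_add_cancel]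

end ChainRule

/-! ### Sobolev inequality on `H¹` -/

section Sobolev

theorem norm_fderiv_le_sum_partialSchwartz {n : ℕ} (φ : 𝓢(EuclideanSpace ℝ (Fin n), ℂ))
    (x : EuclideanSpace ℝ (Fin n)) :
    ‖fderiv ℝ φ x‖ ≤ ∑ i, ‖partialSchwartz i φ x‖ := by
  refine ContinuousLinearMap.opNorm_le_bound _ (Finset.sum_nonneg fun i _ => norm_nonneg _)
    fun y => ?_
  have hy : y = ∑ i, y i • (coordVec i : EuclideanSpace ℝ (Fin n)) := by
    conv_lhs => rw [← (EuclideanSpace.basisFun (Fin n) ℝ).sum_repr y]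
    simp
  conv_lhs => rw [hy]
  rw [map_sum, Finset.sum_mul]
  refine (norm_sum_le _ _).trans (Finset.sum_le_sum fun i _ => ?_)
  rw [map_smul, norm_smul, mul_comm]
  exact mul_le_mul_of_nonneg_left (PiLp.norm_apply_le y i) (norm_nonneg _)

/-- The exponent `2n / (n - 2)`. -/
noncomputable def sobolevExp (n : ℕ) : ℝ≥0 := (2 * n / (n - 2) : ℝ).toNNReal

theorem coe_sobolevExp {n : ℕ} (hn : 2 < n) : (sobolevExp n : ℝ) = 2 * n / (n - 2) := by
  have : (2 : ℝ) < n := by exact_mod_cast hn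
  rw [sobolevExp, Real.coe_toNNReal]
  exact div_nonneg (by positivity) (by linarith)

/-- The constant in the Sobolev inequality `‖u‖_{2n/(n-2)} ≤ C ∑ᵢ ‖∂ᵢu‖₂`. -/
noncomputable def sobolevConst (n : ℕ) : ℝ≥0 :=
  SNormLESNormFDerivOfEqConst ℂ (volume : Measure (EuclideanSpace ℝ (Fin n))) 2

/-- Apply the compactly supported inequality to `χ(x/(k+1)) φ`. The derivative of the cutoff costs
`O(1/k) ‖φ‖₂`, and Fatou passes to the limit. -/
theorem eLpNorm_schwartz_le {n : ℕ} (hn : 2 < n) (φ : 𝓢(EuclideanSpace ℝ (Fin n), ℂ)) :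
    eLpNorm φ (sobolevExp n) volume ≤
      sobolevConst n * ∑ i, eLpNorm (partialSchwartz i φ) 2 volume := by
  let χ : ContDiffBump (0 : EuclideanSpace ℝ (Fin n)) := ⟨1, 2, one_pos, one_lt_two⟩
  have hχ : ContDiff ℝ 1 χ := χ.contDiff
  obtain ⟨B, hB⟩ := (hχ.continuous_fderiv one_ne_zero).bounded_above_of_compact_support
    (χ.hasCompactSupport.fderiv ℝ)
  let c : ℕ → ℝ := fun k => ((k : ℝ) + 1)⁻¹
  have hc : ∀ k, 0 < c k := fun k => by positivity
  have hc0 : Tendsto c atTop (𝓝 0) := by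
    simpa [c, one_div] using tendsto_one_div_add_atTop_nhds_zero_nat (𝕜 := ℝ)
  let f : ℕ → EuclideanSpace ℝ (Fin n) → ℂ := fun k x => χ (c k • x) • φ x
  have hχk : ∀ k x, HasFDerivAt (fun x : EuclideanSpace ℝ (Fin n) => χ (c k • x))
      (c k • fderiv ℝ χ (c k • x)) x := fun k x => by
    have h1 := (hχ.differentiable one_ne_zero (c k • x)).hasFDerivAt.comp x
      ((hasFDerivAt_id x).const_smul (c k))
    refine h1.congr_fderiv ?_
    ext y
    simp
  have hf' : ∀ k x, HasFDerivAt (f k) (χ (c k • x) • fderiv ℝ φ x +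
      (c k • fderiv ℝ χ (c k • x)).smulRight (φ x)) x := fun k x =>
    (hχk k x).smul (φ.hasFDerivAt x)
  have hfC : ∀ k, ContDiff ℝ 1 (f k) := fun k =>
    (hχ.comp (contDiff_const_smul (c k))).smul ((φ.smooth ⊤).of_le (by simp))
  have hfs : ∀ k, HasCompactSupport (f k) := fun k =>
    (χ.hasCompactSupport.comp_smul (hc k).ne').smul_right
  have hfb : ∀ k x, ‖fderiv ℝ (f k) x‖ ≤ ∑ i, ‖partialSchwartz i φ x‖ + c k * B * ‖φ x‖ := by
    intro k x
    rw [(hf' k x).fderiv]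
    refine (norm_add_le _ _).trans (add_le_add ?_ ?_)
    · rw [norm_smul, Real.norm_of_nonneg χ.nonneg]
      exact (mul_le_of_le_one_left (norm_nonneg _) χ.le_one).trans
        (norm_fderiv_le_sum_partialSchwartz φ x)
    · rw [ContinuousLinearMap.norm_smulRight_apply, norm_smul, Real.norm_of_nonneg (hc k).le]
      gcongr
      exact hB _
  have hn' : (2 : ℝ) < n := by exact_mod_cast hn
  have hexp : ((sobolevExp n : ℝ))⁻¹ = ((2 : ℝ≥0) : ℝ)⁻¹ -
      (Module.finrank ℝ (EuclideanSpace ℝ (Fin n)) : ℝ)⁻¹ := by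
    rw [coe_sobolevExp hn, finrank_euclideanSpace, Fintype.card_fin]
    have : (n : ℝ) - 2 ≠ 0 := by linarith
    have : (n : ℝ) ≠ 0 := by linarith
    push_cast
    field_simp
  have hk : ∀ k, eLpNorm (f k) (sobolevExp n) volume ≤ sobolevConst n *
      (∑ i, eLpNorm (partialSchwartz i φ) 2 volume +
        ENNReal.ofReal (c k * |B|) * eLpNorm φ 2 volume) := by
    intro k
    refine (eLpNorm_le_eLpNorm_fderiv_of_eq volume (hfC k) (hfs k) (p := 2) (by norm_num)
      (by rw [finrank_euclideanSpace, Fintype.card_fin]; omega) hexp).trans ?_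
    refine mul_le_mul le_rfl ?_ zero_le zero_le
    have e1 : eLpNorm (fderiv ℝ (f k)) 2 volume ≤ eLpNorm (fun x =>
        ∑ i, ‖partialSchwartz i φ x‖ + c k * |B| * ‖φ x‖) 2 volume := by
      refine eLpNorm_mono_real fun x => (hfb k x).trans ?_
      have := (hc k).le
      gcongr
      exact le_abs_self B
    refine e1.trans ((eLpNorm_add_le ?_ ?_ (by norm_num)).trans (add_le_add ?_ ?_))
    · exact (continuous_finsetSum _ fun i _ =>
        (partialSchwartz i φ).continuous.norm).aestronglyMeasurable
    · exact (φ.continuous.norm.const_mul _).aestronglyMeasurable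
    · have := eLpNorm_sum_le (μ := volume) (p := 2) (s := Finset.univ)
        (f := fun i x => ‖partialSchwartz i φ x‖)
        (fun i _ => (partialSchwartz i φ).continuous.norm.aestronglyMeasurable) (by norm_num)
      refine le_trans (le_of_eq ?_) (this.trans (Finset.sum_le_sum fun i _ =>
        (eLpNorm_norm _).le))
      congr 1
      ext x
      simp
    · refine le_of_eq ?_
      have := eLpNorm_const_smul (c k * |B|) (fun x => ‖φ x‖) 2
        (volume : Measure (EuclideanSpace ℝ (Fin n)))
      rw [eLpNorm_norm, Real.enorm_of_nonneg (mul_nonneg (hc k).le (abs_nonneg _))] at this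
      exact this
  have hlim : Tendsto (fun k => (sobolevConst n : ℝ≥0∞) *
      (∑ i, eLpNorm (partialSchwartz i φ) 2 volume +
        ENNReal.ofReal (c k * |B|) * eLpNorm φ 2 volume)) atTop
      (𝓝 (sobolevConst n * ∑ i, eLpNorm (partialSchwartz i φ) 2 volume)) := by
    have h1 : Tendsto (fun k => ENNReal.ofReal (c k * |B|)) atTop (𝓝 0) := by
      simpa using ENNReal.tendsto_ofReal (hc0.mul_const |B|)
    have h2 := ENNReal.Tendsto.mul_const h1
      (Or.inr (φ.memLp 2 volume).eLpNorm_ne_top : (0 : ℝ≥0∞) ≠ 0 ∨ eLpNorm φ 2 volume ≠ ∞)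
    have h3 := (tendsto_const_nhds
      (x := ∑ i, eLpNorm (partialSchwartz i φ) 2 volume)).add h2
    rw [zero_mul, add_zero] at h3
    exact ENNReal.Tendsto.const_mul h3 (Or.inr ENNReal.coe_ne_top)
  refine (Lp.eLpNorm_lim_le_liminf_eLpNorm (f := f)
    (fun k => (hfC k).continuous.aestronglyMeasurable) φ
    (Eventually.of_forall fun x => ?_)).trans ?_
  · refine tendsto_const_nhds.congr' ?_
    have h1 : Tendsto (fun k => c k • x) atTop (𝓝 0) := by
      simpa using hc0.smul_const x
    filter_upwards [h1.eventually (Metric.closedBall_mem_nhds 0 one_pos)] with k hk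
    simp only [f]
    rw [χ.one_of_mem_closedBall hk, one_smul]
  · rw [← hlim.liminf_eq]
    exact liminf_le_liminf (Eventually.of_forall hk)

/-- The Sobolev inequality on `H¹(ℝⁿ)`, `n > 2`. -/
theorem HasWeakGradient.eLpNorm_le {n : ℕ} (hn : 2 < n) {u : L2 n} {g : Fin n → L2 n}
    (hu : HasWeakGradient u g) :
    eLpNorm u (sobolevExp n) volume ≤ sobolevConst n * ∑ i, ‖g i‖ₑ := by
  obtain ⟨φ, hφ, hφ'⟩ := hu.exists_tendsto_schwartz
  obtain ⟨ns, hns, hae⟩ := (tendstoInMeasure_of_tendsto_Lp hφ).exists_seq_tendsto_ae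
  refine (Lp.eLpNorm_lim_le_liminf_eLpNorm (fun k => Lp.aestronglyMeasurable _) u hae).trans ?_
  have hlim : Tendsto (fun k => (sobolevConst n : ℝ≥0∞) *
      ∑ i, ‖(partialSchwartz i (φ (ns k))).toLp 2 volume‖ₑ) atTop
      (𝓝 (sobolevConst n * ∑ i, ‖g i‖ₑ)) := by
    refine ENNReal.Tendsto.const_mul (tendsto_finsetSum _ fun i _ => ?_)
      (Or.inr ENNReal.coe_ne_top)
    exact (continuous_enorm.tendsto _).comp ((hφ' i).comp hns.tendsto_atTop)
  rw [← hlim.liminf_eq]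
  refine liminf_le_liminf (Eventually.of_forall fun k => ?_)
  rw [eLpNorm_congr_ae (SchwartzMap.coeFn_toLp _ 2 volume)]
  refine (eLpNorm_schwartz_le hn _).trans (le_of_eq ?_)
  congr 1
  refine Finset.sum_congr rfl fun i _ => ?_
  rw [Lp.enorm_def, eLpNorm_congr_ae (SchwartzMap.coeFn_toLp _ 2 volume)]

end Sobolev

/-! ### Primitives of even nonnegative weights -/

section Primitive

/-- The primitive of `ρ` vanishing at the origin. -/
noncomputable def primitive (ρ : ℝ → ℝ) (t : ℝ) : ℝ := ∫ s in (0 : ℝ)..t, ρ s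

variable {ρ : ℝ → ℝ}

theorem hasDerivAt_primitive (hρ : Continuous ρ) (t : ℝ) :
    HasDerivAt (primitive ρ) (ρ t) t :=
  intervalIntegral.integral_hasDerivAt_right (hρ.intervalIntegrable _ _)
    (hρ.stronglyMeasurableAtFilter _ _) hρ.continuousAt

theorem contDiff_primitive (hρ : Continuous ρ) : ContDiff ℝ 1 (primitive ρ) := by
  rw [contDiff_one_iff_deriv]
  refine ⟨fun t => (hasDerivAt_primitive hρ t).differentiableAt, ?_⟩
  rwa [show deriv (primitive ρ) = ρ from funext fun t => (hasDerivAt_primitive hρ t).deriv]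

theorem primitive_zero : primitive ρ 0 = 0 := intervalIntegral.integral_same

theorem primitive_neg (he : ∀ t, ρ (-t) = ρ t) (t : ℝ) : primitive ρ (-t) = -primitive ρ t := by
  have := intervalIntegral.integral_comp_neg (a := 0) (b := t) ρ
  simp only [he, neg_zero] at this
  rw [primitive, primitive, this, intervalIntegral.integral_symm]

theorem abs_primitive_le (h0 : ∀ t, 0 ≤ ρ t) (hm : ∀ s t, |s| ≤ |t| → ρ s ≤ ρ t) (t : ℝ) :
    |primitive ρ t| ≤ |t| * ρ t := by
  have := intervalIntegral.norm_integral_le_of_norm_le_const (a := 0) (b := t) (f := ρ)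
    (C := ρ t) fun x hx => by
      rw [Real.norm_of_nonneg (h0 x)]
      refine hm _ _ ?_
      rcases le_total 0 t with ht | ht
      · rw [Set.uIoc_of_le ht] at hx
        rw [abs_of_pos hx.1, abs_of_nonneg ht]; exact hx.2
      · rw [Set.uIoc_of_ge ht] at hx
        rw [abs_of_nonpos hx.2, abs_of_nonpos ht]; linarith [hx.1]
  rw [sub_zero, mul_comm] at this
  exact this

/-- Only `[t/2, t]` is kept; there the integrand is at least `ρ(t/2)`. -/
theorem le_primitive_of_nonneg (hρ : Continuous ρ) (h0 : ∀ t, 0 ≤ ρ t)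
    (hm : ∀ s t, |s| ≤ |t| → ρ s ≤ ρ t) {t : ℝ} (ht : 0 ≤ t) :
    t / 2 * ρ (t / 2) ≤ primitive ρ t := by
  rw [primitive, ← intervalIntegral.integral_add_adjacent_intervals
    (hρ.intervalIntegrable 0 (t / 2)) (hρ.intervalIntegrable (t / 2) t)]
  have h1 : 0 ≤ ∫ s in (0 : ℝ)..(t / 2), ρ s :=
    intervalIntegral.integral_nonneg (by linarith) fun s _ => h0 s
  have h2 : ∫ _ in (t / 2)..t, ρ (t / 2) ≤ ∫ s in (t / 2)..t, ρ s := by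
    refine intervalIntegral.integral_mono_on (by linarith) (by simp)
      (hρ.intervalIntegrable _ _) fun s hs => hm _ _ ?_
    rw [abs_of_nonneg (by linarith), abs_of_nonneg (by linarith [hs.1])]
    exact hs.1
  rw [intervalIntegral.integral_const, smul_eq_mul] at h2
  linarith

theorem le_abs_primitive (hρ : Continuous ρ) (h0 : ∀ t, 0 ≤ ρ t)
    (hm : ∀ s t, |s| ≤ |t| → ρ s ≤ ρ t) (t : ℝ) :
    |t| / 2 * ρ (t / 2) ≤ |primitive ρ t| := by
  -- Monotonicity in `|t|` forces evenness, so the primitive is odd.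
  have he : ∀ t, ρ (-t) = ρ t := fun t =>
    le_antisymm (hm _ _ (abs_neg t).le) (hm _ _ (abs_neg t).ge)
  rcases le_total 0 t with ht | ht
  · rw [abs_of_nonneg ht]
    exact (le_primitive_of_nonneg hρ h0 hm ht).trans (le_abs_self _)
  · have h := le_primitive_of_nonneg hρ h0 hm (t := -t) (by linarith)
    rw [primitive_neg he, neg_div, he, ← neg_div] at h
    rw [abs_of_nonpos ht]
    exact h.trans (neg_le_abs _)

/-- This sign allows the potential term to be discarded whatever its size. -/
theorem mul_primitive_nonneg (h0 : ∀ t, 0 ≤ ρ t) (t : ℝ) : 0 ≤ t * primitive ρ t := by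
  rcases le_total 0 t with ht | ht
  · exact mul_nonneg ht (intervalIntegral.integral_nonneg ht fun s _ => h0 s)
  · refine mul_nonneg_of_nonpos_of_nonpos ht ?_
    rw [primitive, intervalIntegral.integral_symm, neg_nonpos]
    exact intervalIntegral.integral_nonneg ht fun s _ => h0 s

/-- `z ↦ primitive ρ (re z)` as a map `ℂ → ℂ`. -/
noncomputable def rePrimitive (ρ : ℝ → ℝ) (z : ℂ) : ℂ := (primitive ρ z.re : ℂ)

theorem rePrimitive_zero : rePrimitive ρ 0 = 0 := by
  simp [rePrimitive, primitive_zero]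

theorem contDiff_rePrimitive (hρ : Continuous ρ) : ContDiff ℝ 1 (rePrimitive ρ) :=
  Complex.ofRealCLM.contDiff.comp ((contDiff_primitive hρ).comp Complex.reCLM.contDiff)

theorem fderiv_rePrimitive (hρ : Continuous ρ) (z w : ℂ) :
    fderiv ℝ (rePrimitive ρ) z w = ((ρ z.re * w.re : ℝ) : ℂ) := by
  have h1 := Complex.ofRealCLM.hasFDerivAt.comp z
    ((hasDerivAt_primitive hρ z.re).comp_hasFDerivAt z Complex.reCLM.hasFDerivAt)
  have h2 : fderiv ℝ (rePrimitive ρ) z = _ := h1.fderiv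
  rw [h2]
  rfl

theorem nnnorm_fderiv_rePrimitive_le (hρ : Continuous ρ) {B : ℝ≥0} (hB : ∀ t, |ρ t| ≤ B)
    (z : ℂ) : ‖fderiv ℝ (rePrimitive ρ) z‖₊ ≤ B := by
  refine ContinuousLinearMap.opNorm_le_bound _ B.2 fun w => ?_
  rw [fderiv_rePrimitive hρ, Complex.norm_real, norm_mul]
  exact mul_le_mul (hB _) (Complex.abs_re_le_norm w) (norm_nonneg _) B.2

end Primitive

/-! ### Energy estimate by nonlinear testing -/

/-- The weak chain rule for `rePrimitive ρ`. -/
theorem HasWeakGradient.exists_rePrimitive {n : ℕ} {u : L2 n} {g : Fin n → L2 n}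
    (hu : HasWeakGradient u g) {ρ : ℝ → ℝ} (hρ : Continuous ρ) {B : ℝ≥0} (hB : ∀ t, |ρ t| ≤ B) :
    ∃ (v : L2 n) (h : Fin n → L2 n), HasWeakGradient v h ∧
      (∀ᵐ x, v x = (primitive ρ (u x).re : ℂ)) ∧
      ∀ i, ∀ᵐ x, h i x = ((ρ (u x).re * (g i x).re : ℝ) : ℂ) := by
  have hC := nnnorm_fderiv_rePrimitive_le hρ hB
  refine ⟨_, _, hu.comp (contDiff_rePrimitive hρ) rePrimitive_zero hC,
    LipschitzWith.coeFn_compLp _ _ u, fun i => ?_⟩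
  filter_upwards [coeFn_fderivLp (contDiff_rePrimitive hρ) hC u (g i)] with x hx
  rw [hx, fderiv_rePrimitive hρ]

theorem MemSqrtDomain.of_norm_le {n : ℕ} {q : EuclideanSpace ℝ (Fin n) → ℝ}
    (hq : AEStronglyMeasurable q volume) {u v : L2 n} (hu : MemSqrtDomain q u) {B : ℝ}
    (h : ∀ᵐ x, ‖v x‖ ≤ B * ‖u x‖) : MemSqrtDomain q v := by
  refine MemLp.of_le_mul (c := B) hu
    (((Complex.continuous_ofReal.comp Real.continuous_sqrt).comp_aestronglyMeasurable hq).mul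
      (Lp.aestronglyMeasurable v)) ?_
  filter_upwards [h] with x hx
  rw [norm_mul, norm_mul, mul_left_comm]
  exact mul_le_mul_of_nonneg_left hx (norm_nonneg _)

/-- The energy estimate obtained by testing the equation `(q - Δ) u = w` with a nonlinear
function of `re u`. -/
theorem IsSchrodinger.energy_le {n : ℕ} {q : EuclideanSpace ℝ (Fin n) → ℝ}
    (hq : AEStronglyMeasurable q volume) (hq0 : ∀ x, 0 ≤ q x) {u w : L2 n}
    (hu : IsSchrodinger q u w) {ρ : ℝ → ℝ} (hρ : Continuous ρ) {B : ℝ≥0} (hB : ∀ t, |ρ t| ≤ B) :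
    ∃ (G v : L2 n) (k : Fin n → L2 n), HasWeakGradient G k ∧
      (∀ᵐ x, G x = (primitive ρ (u x).re : ℂ)) ∧
      (∀ᵐ x, v x = (primitive (fun t => ρ t ^ 2) (u x).re : ℂ)) ∧
      ∑ i, ‖k i‖ ^ 2 ≤ ‖v‖ * ‖w‖ := by
  obtain ⟨g, hg, hqu, heq⟩ := hu
  have hρ2 : Continuous fun t => ρ t ^ 2 := hρ.pow 2
  have hB2 : ∀ t, |ρ t ^ 2| ≤ ((B ^ 2 : ℝ≥0) : ℝ) := fun t => by
    rw [abs_pow]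
    push_cast
    exact pow_le_pow_left₀ (abs_nonneg _) (hB t) 2
  -- The test function `v` has weight `ρ²` and `G` has weight `ρ`, so `re ⟨∇u, ∇v⟩ = ρ² |∇ re u|² =
  -- |∇G|²`.
  obtain ⟨G, k, hGk, hG, hk⟩ := hg.exists_rePrimitive hρ hB
  obtain ⟨v, h, hvh, hv, hh⟩ := hg.exists_rePrimitive hρ2 hB2
  refine ⟨G, v, k, hGk, hG, hv, ?_⟩
  have hLip := lipschitzWith_of_fderiv_bound (contDiff_rePrimitive hρ2)
    (nnnorm_fderiv_rePrimitive_le hρ2 hB2)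
  have hvq : MemSqrtDomain q v := hqu.of_norm_le hq (B := ((B ^ 2 : ℝ≥0) : ℝ)) (by
    filter_upwards [hv] with x hx
    have := hLip.dist_le_mul (u x) 0
    rw [rePrimitive_zero, dist_zero_right, dist_zero_right] at this
    rw [hx]
    exact this)
  have key := congrArg Complex.re (heq v h hvh hvq)
  have h1 : ∀ i, (inner ℂ (h i) (g i)).re = ‖k i‖ ^ 2 := by
    intro i
    rw [← inner_self_eq_norm_sq (𝕜 := ℂ) (k i), L2.inner_def, L2.inner_def]
    change Complex.reCLM _ = Complex.reCLM _
    rw [← Complex.reCLM.integral_comp_comm (L2.integrable_inner (𝕜 := ℂ) (h i) (g i)),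
      ← Complex.reCLM.integral_comp_comm (L2.integrable_inner (𝕜 := ℂ) (k i) (k i))]
    refine integral_congr_ae ?_
    filter_upwards [hh i, hk i] with x hx1 hx2
    rw [hx1, hx2, RCLike.inner_apply, RCLike.inner_apply, Complex.conj_ofReal,
      Complex.conj_ofReal, Complex.reCLM_apply, Complex.reCLM_apply, Complex.re_mul_ofReal,
      Complex.re_mul_ofReal, Complex.ofReal_re]
    ring
  have h2 : 0 ≤ (∫ x, (q x : ℂ) * u x * (starRingEnd ℂ) (v x)).re := by
    -- Without integrability the integral is zero by convention, and the sign still holds.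
    by_cases hi : Integrable (fun x => (q x : ℂ) * u x * (starRingEnd ℂ) (v x)) volume
    · change 0 ≤ Complex.reCLM _
      rw [← Complex.reCLM.integral_comp_comm hi]
      refine integral_nonneg_of_ae ?_
      filter_upwards [hv] with x hx
      rw [hx, Complex.conj_ofReal, Complex.reCLM_apply, Complex.re_mul_ofReal,
        Complex.re_ofReal_mul, mul_assoc]
      exact mul_nonneg (hq0 x) (mul_primitive_nonneg (fun t => sq_nonneg _) _)
    · rw [integral_undef hi]
      simp
  rw [Complex.add_re, Complex.re_sum, Finset.sum_congr rfl fun i _ => h1 i] at key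
  have h3 : (inner ℂ v w).re ≤ ‖v‖ * ‖w‖ :=
    (Complex.re_le_norm _).trans (norm_inner_le_norm v w)
  linarith

/-! ### Truncated powers -/

section Truncation

/-- The truncated power `min(|t|, M)^a`. -/
noncomputable def truncPow (M a t : ℝ) : ℝ := min |t| M ^ a

variable {M a : ℝ}

theorem continuous_truncPow (ha : 0 ≤ a) : Continuous (truncPow M a) :=
  (continuous_abs.min continuous_const).rpow_const fun _ => Or.inr ha

theorem truncPow_nonneg (hM : 0 ≤ M) (t : ℝ) : 0 ≤ truncPow M a t :=
  Real.rpow_nonneg (le_min (abs_nonneg t) hM) a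

theorem truncPow_mono (hM : 0 ≤ M) (ha : 0 ≤ a) (s t : ℝ) (h : |s| ≤ |t|) :
    truncPow M a s ≤ truncPow M a t :=
  Real.rpow_le_rpow (le_min (abs_nonneg s) hM) (min_le_min_right M h) ha

theorem abs_truncPow_le (hM : 0 ≤ M) (ha : 0 ≤ a) (t : ℝ) :
    |truncPow M a t| ≤ ((M ^ a).toNNReal : ℝ) := by
  rw [abs_of_nonneg (truncPow_nonneg hM t), Real.coe_toNNReal _ (Real.rpow_nonneg hM a)]
  exact Real.rpow_le_rpow (le_min (abs_nonneg t) hM) (min_le_right _ _) ha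

/-- Halving the argument costs at most a factor `2^a` in the weight, uniformly in `M`. -/
theorem mul_truncPow_le_primitive (hM : 0 ≤ M) (ha : 0 ≤ a) (t : ℝ) :
    |t| * truncPow M a t ≤ 2 ^ (a + 1) * |primitive (truncPow M a) t| := by
  have h1 := le_abs_primitive (continuous_truncPow ha) (truncPow_nonneg hM)
    (truncPow_mono hM ha) t
  have h2 : truncPow M a t ≤ 2 ^ a * truncPow M a (t / 2) := by
    rw [truncPow, truncPow, ← Real.mul_rpow zero_le_two (le_min (abs_nonneg _) hM)]
    refine Real.rpow_le_rpow (le_min (abs_nonneg t) hM) ?_ ha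
    rw [abs_div, abs_two, mul_min_of_nonneg _ _ zero_le_two]
    exact min_le_min (by linarith) (by linarith)
  calc |t| * truncPow M a t ≤ |t| * (2 ^ a * truncPow M a (t / 2)) := by gcongr
    _ = 2 ^ (a + 1) * (|t| / 2 * truncPow M a (t / 2)) := by
      rw [Real.rpow_add_one two_ne_zero]; ring
    _ ≤ _ := by gcongr

/-- With `s = min(|t|, M)`, the relation on `a` and `θ` reads `2a = (θ-1) + aθ`. Thus `|t|s^{2a} =
|t|s^{θ-1}s^{aθ}`, and `s ≤ |t|` is used in the middle factor only. -/
theorem primitive_truncPow_sq_le (hM : 0 < M) (ha : 0 < a) {θ : ℝ} (hθ : 1 ≤ θ)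
    (haθ : a * (2 - θ) = θ - 1) (t : ℝ) :
    |primitive (fun s => truncPow M a s ^ 2) t| ≤ (|t| * truncPow M a t) ^ θ := by
  refine (abs_primitive_le (fun s => sq_nonneg _) (fun s r h =>
    pow_le_pow_left₀ (truncPow_nonneg hM.le s) (truncPow_mono hM.le ha.le s r h) 2) t).trans ?_
  rcases eq_or_ne t 0 with rfl | ht
  · rw [abs_zero, zero_mul, zero_mul]
    exact Real.rpow_nonneg le_rfl _
  have ht' : 0 < |t| := abs_pos.2 ht
  have hs : 0 < min |t| M := lt_min ht' hM
  rw [Real.mul_rpow ht'.le (truncPow_nonneg hM.le t), truncPow, ← Real.rpow_natCast,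
    ← Real.rpow_mul hs.le, ← Real.rpow_mul hs.le,
    show a * ((2 : ℕ) : ℝ) = (θ - 1) + a * θ by push_cast; linarith, Real.rpow_add hs,
    ← mul_assoc]
  refine mul_le_mul_of_nonneg_right ?_ (Real.rpow_nonneg hs.le _)
  calc |t| * min |t| M ^ (θ - 1) ≤ |t| * |t| ^ (θ - 1) := by
        gcongr
        exact min_le_left _ _
    _ = |t| ^ θ := by
      rw [← Real.rpow_one_add' ht'.le (by linarith)]
      congr 1
      ring

end Truncation

/-! ### The `L^{2n/(n-4)}` estimate, uniform in the potential -/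

/-- The exponent `2n / (n - 4)`. -/
noncomputable def sobolevExpTwo (n : ℕ) : ℝ≥0 := (2 * n / (n - 4) : ℝ).toNNReal

theorem sobolevExp_mul {n : ℕ} (hn : 4 < n) :
    (sobolevExp n : ℝ≥0∞) * ENNReal.ofReal (2 / ((n : ℝ) - 4) + 1) = sobolevExpTwo n := by
  have hn' : (4 : ℝ) < n := by exact_mod_cast hn
  have h2 : (0 : ℝ) < n - 2 := by linarith
  have h4 : (0 : ℝ) < n - 4 := by linarith
  change ENNReal.ofReal _ * _ = ENNReal.ofReal _
  rw [← ENNReal.ofReal_mul (by positivity)]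
  congr 1
  field_simp
  ring

theorem two_mul_ofReal_eq_sobolevExp {n : ℕ} :
    (2 : ℝ≥0∞) * ENNReal.ofReal ((n : ℝ) / (n - 2)) = sobolevExp n := by
  change _ = ENNReal.ofReal _
  rw [← ENNReal.ofReal_ofNat 2, ← ENNReal.ofReal_mul zero_le_two, mul_div_assoc]

theorem le_rpow_of_sq_le {X K W θ b : ℝ} (hX : 0 ≤ X) (hb : 0 ≤ b)
    (hbθ : (2 - θ) * b = 1) (h : X ^ 2 ≤ K * (X ^ θ * W)) (hKW : 0 ≤ K * W) :
    X ≤ (K * W) ^ b := by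
  rcases hX.eq_or_lt with rfl | hX'
  · exact Real.rpow_nonneg hKW b
  have h1 : X ^ (2 - θ) ≤ K * W := by
    rw [Real.rpow_sub hX', Real.rpow_two, div_le_iff₀ (Real.rpow_pos_of_pos hX' θ)]
    linarith
  calc X = (X ^ (2 - θ)) ^ b := by rw [← Real.rpow_mul hX, hbθ, Real.rpow_one]
    _ ≤ (K * W) ^ b := Real.rpow_le_rpow (Real.rpow_nonneg hX _) h1 hb

/-- The constant in the estimate `‖re u‖_{2n/(n-4)} ≤ K ‖(q - Δ) u‖₂`. -/
noncomputable def resolventConst (n : ℕ) : ℝ :=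
  (2 ^ (2 / ((n : ℝ) - 4) + 1) * sobolevConst n) ^ 2 * n

theorem resolventConst_nonneg (n : ℕ) : 0 ≤ resolventConst n :=
  mul_nonneg (sq_nonneg _) n.cast_nonneg

section Estimate

variable {n : ℕ} {q : EuclideanSpace ℝ (Fin n) → ℝ} {u w : L2 n}

/-- Truncation keeps the weight bounded, which makes the test function admissible and the left side
finite; the bound does not involve `M`. The choice of `a` closes the estimate: `θ = n/(n-2)`
satisfies `2θ = 2n/(n-2)` and `1/(2-θ) = a + 1`. -/
theorem IsSchrodinger.eLpNorm_re_mul_truncPow_le (hn : 4 < n) (hq : AEStronglyMeasurable q volume)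
    (hq0 : ∀ x, 0 ≤ q x) (hu : IsSchrodinger q u w) {M : ℝ} (hM : 0 < M) :
    eLpNorm (fun x => |(u x).re| * truncPow M (2 / ((n : ℝ) - 4)) (u x).re) (sobolevExp n) volume ≤
      ENNReal.ofReal ((resolventConst n * ‖w‖) ^ (2 / ((n : ℝ) - 4) + 1)) := by
  have hn' : (4 : ℝ) < n := by exact_mod_cast hn
  have h2 : (0 : ℝ) < n - 2 := by linarith
  have h4 : (0 : ℝ) < n - 4 := by linarith
  set a : ℝ := 2 / ((n : ℝ) - 4) with ha_def
  have ha : 0 < a := by positivity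
  set θ : ℝ := (n : ℝ) / (n - 2) with hθ_def
  have hθ1 : 1 ≤ θ := by rw [hθ_def, le_div_iff₀ h2]; linarith
  have haθ : a * (2 - θ) = θ - 1 := by
    rw [ha_def, hθ_def]; field_simp; ring
  obtain ⟨G, v, k, hGk, hG, hv, hE⟩ :=
    hu.energy_le hq hq0 (continuous_truncPow ha.le) (abs_truncPow_le hM.le ha.le)
  set P := eLpNorm (fun x => |(u x).re| * truncPow M a (u x).re) (sobolevExp n) volume with hP
  set b : ℝ := 2 ^ (a + 1) with hb_def
  have hb : 0 ≤ b := by positivity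
  have hnn : ∀ x, 0 ≤ |(u x).re| * truncPow M a (u x).re := fun x =>
    mul_nonneg (abs_nonneg _) (truncPow_nonneg hM.le _)
  have hP1 : P ≤ ENNReal.ofReal (b * sobolevConst n * ∑ i, ‖k i‖) := by
    have h1 : P ≤ ENNReal.ofReal b * eLpNorm G (sobolevExp n) volume := by
      refine eLpNorm_le_mul_eLpNorm_of_ae_le_mul ?_ _
      filter_upwards [hG] with x hx
      rw [hx, Real.norm_of_nonneg (hnn x), Complex.norm_real]
      exact mul_truncPow_le_primitive hM.le ha.le _
    refine h1.trans ((mul_le_mul_right (hGk.eLpNorm_le (by omega)) _).trans (le_of_eq ?_))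
    rw [ENNReal.ofReal_mul (by positivity), ENNReal.ofReal_mul hb,
      ENNReal.ofReal_sum_of_nonneg (fun i _ => norm_nonneg _), ENNReal.ofReal_coe_nnreal, mul_assoc]
    simp only [ofReal_norm]
  -- Finiteness is essential: a power of this norm is divided out below.
  have hPtop : P ≠ ∞ := (hP1.trans_lt ENNReal.ofReal_lt_top).ne
  have hX0 : 0 ≤ P.toReal := ENNReal.toReal_nonneg
  have hX1 : P.toReal ≤ b * sobolevConst n * ∑ i, ‖k i‖ :=
    ENNReal.toReal_le_of_le_ofReal (by positivity) hP1
  have hv1 : ‖v‖ ≤ P.toReal ^ θ := by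
    have h1 : eLpNorm v 2 volume ≤ P ^ θ := by
      calc eLpNorm v 2 volume ≤ eLpNorm (fun x =>
            ‖|(u x).re| * truncPow M a (u x).re‖ ^ θ) 2 volume := by
              refine eLpNorm_mono_ae_real ?_
              filter_upwards [hv] with x hx
              rw [hx, Complex.norm_real, Real.norm_of_nonneg (hnn x)]
              exact primitive_truncPow_sq_le hM ha hθ1 haθ _
        _ = P ^ θ := by
          rw [eLpNorm_norm_rpow _ (by linarith), two_mul_ofReal_eq_sobolevExp]
    rw [Lp.norm_def, ENNReal.toReal_rpow]
    exact ENNReal.toReal_mono (ENNReal.rpow_ne_top_of_nonneg (by linarith) hPtop) h1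
  -- Cauchy–Schwarz over the coordinates is the source of the factor `n` in `resolventConst`.
  have hsum : (∑ i, ‖k i‖) ^ 2 ≤ n * ∑ i, ‖k i‖ ^ 2 := by
    have := sq_sum_le_card_mul_sum_sq (s := Finset.univ) (f := fun i => ‖k i‖)
    rwa [Finset.card_univ, Fintype.card_fin] at this
  have hX2 : P.toReal ^ 2 ≤ resolventConst n * (P.toReal ^ θ * ‖w‖) := by
    calc P.toReal ^ 2 ≤ (b * sobolevConst n * ∑ i, ‖k i‖) ^ 2 := pow_le_pow_left₀ hX0 hX1 2
      _ = (b * sobolevConst n) ^ 2 * (∑ i, ‖k i‖) ^ 2 := mul_pow _ _ _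
      _ ≤ (b * sobolevConst n) ^ 2 * (n * (P.toReal ^ θ * ‖w‖)) := by
        refine mul_le_mul_of_nonneg_left (hsum.trans ?_) (sq_nonneg _)
        refine mul_le_mul_of_nonneg_left (hE.trans ?_) n.cast_nonneg
        exact mul_le_mul_of_nonneg_right hv1 (norm_nonneg _)
      _ = resolventConst n * (P.toReal ^ θ * ‖w‖) := by
        rw [resolventConst]; ring
  have hfin := le_rpow_of_sq_le (b := a + 1) hX0 (by positivity)
    (by rw [ha_def, hθ_def]; field_simp; ring) hX2
    (mul_nonneg (resolventConst_nonneg n) (norm_nonneg w))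
  rw [← ENNReal.ofReal_toReal hPtop]
  exact ENNReal.ofReal_le_ofReal hfin

/-- Fatou as `M → ∞` bounds `|re u|^{a+1}` in `L^{2n/(n-2)}`; the power scales the exponent to
`2n/(n-4)` and cancels on both sides. -/
theorem IsSchrodinger.eLpNorm_re_le (hn : 4 < n) (hq : AEStronglyMeasurable q volume)
    (hq0 : ∀ x, 0 ≤ q x) (hu : IsSchrodinger q u w) :
    eLpNorm (fun x => (u x).re) (sobolevExpTwo n) volume ≤
      ENNReal.ofReal (resolventConst n * ‖w‖) := by
  have hn' : (4 : ℝ) < n := by exact_mod_cast hn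
  have h4 : (0 : ℝ) < n - 4 := by linarith
  set a : ℝ := 2 / ((n : ℝ) - 4) with ha_def
  have ha : 0 < a := by positivity
  have hre : AEStronglyMeasurable (fun x => (u x).re) volume :=
    Complex.continuous_re.comp_aestronglyMeasurable (Lp.aestronglyMeasurable u)
  have h1 : eLpNorm (fun x => ‖(u x).re‖ ^ (a + 1)) (sobolevExp n) volume ≤
      ENNReal.ofReal ((resolventConst n * ‖w‖) ^ (a + 1)) := by
    refine (Lp.eLpNorm_lim_le_liminf_eLpNorm (f := fun (k : ℕ) x =>
      |(u x).re| * truncPow ((k : ℝ) + 1) a (u x).re) (fun k => ?_) _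
      (Eventually.of_forall fun x => ?_)).trans ?_
    · exact (continuous_abs.mul (continuous_truncPow ha.le)).comp_aestronglyMeasurable hre
    · refine tendsto_const_nhds.congr' ?_
      filter_upwards [eventually_ge_atTop ⌈|(u x).re|⌉₊] with k hk
      have : |(u x).re| ≤ (k : ℝ) + 1 := by
        have := Nat.ceil_le.1 hk
        linarith
      rw [truncPow, min_eq_left this, Real.norm_eq_abs, add_comm a 1,
        Real.rpow_one_add' (abs_nonneg _) (add_pos one_pos ha).ne']
    · refine (liminf_le_liminf (Eventually.of_forall fun k =>
        hu.eLpNorm_re_mul_truncPow_le hn hq hq0 (Nat.cast_add_one_pos k))).trans ?_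
      rw [liminf_const]
  rw [eLpNorm_norm_rpow _ (by positivity), sobolevExp_mul hn, ← ENNReal.ofReal_rpow_of_nonneg
    (mul_nonneg (resolventConst_nonneg n) (norm_nonneg w)) (by positivity)] at h1
  exact (ENNReal.rpow_le_rpow_iff (by positivity)).1 h1

/-- Used with `c = -i`, which moves `im u` into the real part. -/
theorem IsSchrodinger.const_smul (hu : IsSchrodinger q u w) (c : ℂ) :
    IsSchrodinger q (c • u) (c • w) := by
  obtain ⟨g, hg, hqu, heq⟩ := hu
  refine ⟨fun i => c • g i, hg.const_smul c, ?_, fun v h hv hqv => ?_⟩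
  · refine (MemLp.const_smul hqu c).ae_eq ?_
    filter_upwards [Lp.coeFn_smul c u] with x hx
    rw [hx, Pi.smul_apply, Pi.smul_apply, smul_eq_mul, smul_eq_mul, mul_left_comm]
  · rw [inner_smul_right, ← heq v h hv hqv, mul_add, Finset.mul_sum]
    congr 1
    · exact Finset.sum_congr rfl fun i _ => inner_smul_right _ _ _
    · rw [← integral_const_mul]
      refine integral_congr_ae ?_
      filter_upwards [Lp.coeFn_smul c u] with x hx
      rw [hx, Pi.smul_apply, smul_eq_mul]
      ring

theorem one_le_sobolevExpTwo (hn : 4 < n) : 1 ≤ (sobolevExpTwo n : ℝ≥0∞) := by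
  have hn' : (4 : ℝ) < n := by exact_mod_cast hn
  change 1 ≤ ENNReal.ofReal _
  rw [ENNReal.one_le_ofReal, le_div_iff₀ (by linarith)]
  linarith

/-- The estimate `‖u‖_{2n/(n-4)} ≤ C ‖(q - Δ) u‖₂` with a constant independent of `q ≥ 0`. -/
theorem IsSchrodinger.eLpNorm_le (hn : 4 < n) (hq : AEStronglyMeasurable q volume)
    (hq0 : ∀ x, 0 ≤ q x) (hu : IsSchrodinger q u w) :
    eLpNorm u (sobolevExpTwo n) volume ≤ ENNReal.ofReal (2 * resolventConst n * ‖w‖) := by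
  have h1 := hu.eLpNorm_re_le hn hq hq0
  have h2 := (hu.const_smul (-Complex.I)).eLpNorm_re_le hn hq hq0
  have e : (fun x => ((-Complex.I • u : L2 n) x).re) =ᵐ[volume] fun x => (u x).im := by
    filter_upwards [Lp.coeFn_smul (-Complex.I) u] with x hx
    rw [hx]
    simp
  rw [eLpNorm_congr_ae e, norm_smul, norm_neg, Complex.norm_I, one_mul] at h2
  have hm := Lp.aestronglyMeasurable u
  calc eLpNorm u (sobolevExpTwo n) volume ≤
        eLpNorm (fun x => ‖(u x).re‖ + ‖(u x).im‖) (sobolevExpTwo n) volume :=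
          eLpNorm_mono_real fun x => Complex.norm_le_abs_re_add_abs_im _
    _ ≤ eLpNorm (fun x => ‖(u x).re‖) (sobolevExpTwo n) volume +
        eLpNorm (fun x => ‖(u x).im‖) (sobolevExpTwo n) volume :=
      eLpNorm_add_le (Complex.continuous_re.comp_aestronglyMeasurable hm).norm
        (Complex.continuous_im.comp_aestronglyMeasurable hm).norm (one_le_sobolevExpTwo hn)
    _ ≤ ENNReal.ofReal (resolventConst n * ‖w‖) + ENNReal.ofReal (resolventConst n * ‖w‖) := by
      rw [eLpNorm_norm, eLpNorm_norm]
      exact add_le_add h1 h2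
    _ = _ := by
      rw [← ENNReal.ofReal_add (mul_nonneg (resolventConst_nonneg n) (norm_nonneg w))
        (mul_nonneg (resolventConst_nonneg n) (norm_nonneg w))]
      congr 1
      ring

end Estimate

/-! ### Hölder exponents and the form domain for `V ∈ L^{n/2}` -/

section Holder

theorem natCast_eq_ofReal (n : ℕ) : (n : ℝ≥0∞) = ENNReal.ofReal n :=
  (ENNReal.ofReal_natCast n).symm

theorem natCast_div_two_eq_ofReal (n : ℕ) : (n : ℝ≥0∞) / 2 = ENNReal.ofReal ((n : ℝ) / 2) := by
  rw [ENNReal.ofReal_div_of_pos two_pos, ENNReal.ofReal_natCast, ENNReal.ofReal_ofNat]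

theorem holderTriple_ofReal {p q r : ℝ} (hp : 0 < p) (hq : 0 < q) (hr : 0 < r)
    (h : p⁻¹ + q⁻¹ = r⁻¹) :
    (ENNReal.ofReal p).HolderTriple (ENNReal.ofReal q) (ENNReal.ofReal r) := by
  constructor
  rw [← ENNReal.ofReal_inv_of_pos hp, ← ENNReal.ofReal_inv_of_pos hq,
    ← ENNReal.ofReal_inv_of_pos hr, ← ENNReal.ofReal_add (by positivity) (by positivity), h]

theorem holderTriple_half_sobolevExpTwo {n : ℕ} (hn : 4 < n) :
    ((n : ℝ≥0∞) / 2).HolderTriple (sobolevExpTwo n) 2 := by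
  have hn' : (4 : ℝ) < n := by exact_mod_cast hn
  have h4 : (0 : ℝ) < n - 4 := by linarith
  rw [natCast_div_two_eq_ofReal, ← ENNReal.ofReal_ofNat 2]
  refine holderTriple_ofReal (by positivity) (by positivity) two_pos ?_
  field_simp
  ring

theorem holderTriple_sobolevExp {n : ℕ} (hn : 2 < n) :
    (n : ℝ≥0∞).HolderTriple (sobolevExp n) 2 := by
  have hn' : (2 : ℝ) < n := by exact_mod_cast hn
  have h4 : (0 : ℝ) < n - 2 := by linarith
  rw [natCast_eq_ofReal, ← ENNReal.ofReal_ofNat 2]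
  refine holderTriple_ofReal (by positivity) (by positivity) two_pos ?_
  field_simp
  ring

variable {n : ℕ} {V : EuclideanSpace ℝ (Fin n) → ℂ}

theorem memLp_sqrt_norm (hV : MemLp V ((n : ℝ≥0∞) / 2) volume) :
    MemLp (fun x => (Real.sqrt ‖V x‖ : ℂ)) n volume := by
  refine ⟨(Complex.continuous_ofReal.comp Real.continuous_sqrt).comp_aestronglyMeasurable
    hV.1.norm, ?_⟩
  have e : eLpNorm (fun x => (Real.sqrt ‖V x‖ : ℂ)) n volume =
      eLpNorm (fun x => ‖V x‖ ^ (1 / 2 : ℝ)) n volume :=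
    eLpNorm_congr_norm_ae (Eventually.of_forall fun x => by
      simp only [Complex.norm_real, Real.sqrt_eq_rpow])
  rw [e, eLpNorm_norm_rpow _ (by norm_num), one_div, ENNReal.ofReal_inv_of_pos two_pos,
    ENNReal.ofReal_ofNat, ← div_eq_mul_inv]
  exact ENNReal.rpow_lt_top_of_nonneg (by norm_num) hV.2.ne

/-- For `V ∈ L^{n/2}`, the form domain of `|V| - Δ` is all of `H¹`. -/
theorem HasWeakGradient.memSqrtDomain (hn : 2 < n) (hV : MemLp V ((n : ℝ≥0∞) / 2) volume)
    {v : L2 n} {h : Fin n → L2 n} (hv : HasWeakGradient v h) :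
    MemSqrtDomain (fun x => ‖V x‖) v := by
  have := holderTriple_sobolevExp hn
  have h1 : MemLp v (sobolevExp n) volume := by
    refine ⟨Lp.aestronglyMeasurable v, (hv.eLpNorm_le hn).trans_lt ?_⟩
    exact ENNReal.mul_lt_top ENNReal.coe_lt_top (ENNReal.sum_lt_top.2 fun i _ => enorm_lt_top)
  exact h1.smul (memLp_sqrt_norm hV)

end Holder

/-! ### The inclusion -/

theorem proposition5p6 (n : ℕ) (hn : 4 < n) :
    {V : EuclideanSpace ℝ (Fin n) → ℂ | MemLp V ((n : ℝ≥0∞) / 2) volume} ⊆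
      potentialClassW2 n := by
  intro V hV
  have hn' : (4 : ℝ) < n := by exact_mod_cast hn
  have := holderTriple_half_sobolevExpTwo hn
  change MemLp V ((n : ℝ≥0∞) / 2) volume at hV
  refine ⟨hV.locallyIntegrable ?_, ?_⟩
  · rw [natCast_div_two_eq_ofReal, ENNReal.one_le_ofReal]
    linarith
  set A : ℝ := (eLpNorm V ((n : ℝ≥0∞) / 2) volume).toReal * (2 * resolventConst n) with hA
  -- From `‖z‖ ≤ A‖w‖` and `‖w - z‖ ≤ (1 + A)‖w‖`.
  refine ⟨2 * A + 1, fun u w hu => ?_⟩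
  have hq : AEStronglyMeasurable (fun x => ‖V x‖) volume := hV.1.norm
  have hqC : AEStronglyMeasurable (fun x => (‖V x‖ : ℂ)) volume :=
    Complex.continuous_ofReal.comp_aestronglyMeasurable hq
  have hLu := hu.eLpNorm_le hn hq fun x => norm_nonneg _
  have hbound : eLpNorm (fun x => (‖V x‖ : ℂ) * u x) 2 volume ≤ ENNReal.ofReal (A * ‖w‖) := by
    refine (eLpNorm_smul_le_mul_eLpNorm (p := (n : ℝ≥0∞) / 2) (q := sobolevExpTwo n)
      (Lp.aestronglyMeasurable u) hqC).trans ?_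
    have e : eLpNorm (fun x => (‖V x‖ : ℂ)) ((n : ℝ≥0∞) / 2) volume =
        ENNReal.ofReal (eLpNorm V ((n : ℝ≥0∞) / 2) volume).toReal := by
      rw [ENNReal.ofReal_toReal hV.eLpNorm_ne_top]
      exact eLpNorm_congr_norm_ae (Eventually.of_forall fun x => by simp)
    rw [e, hA, mul_assoc, ENNReal.ofReal_mul ENNReal.toReal_nonneg]
    exact mul_le_mul_right hLu _
  have hA0 : 0 ≤ A * ‖w‖ := mul_nonneg (mul_nonneg ENNReal.toReal_nonneg
    (mul_nonneg zero_le_two (resolventConst_nonneg n))) (norm_nonneg w)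
  have hmem : MemLp (fun x => (‖V x‖ : ℂ) * u x) 2 volume :=
    ⟨hqC.mul (Lp.aestronglyMeasurable u), hbound.trans_lt ENNReal.ofReal_lt_top⟩
  set z : L2 n := hmem.toLp _ with hz
  have hzae : ∀ᵐ x, z x = (‖V x‖ : ℂ) * u x := hmem.coeFn_toLp
  have hznorm : ‖z‖ ≤ A * ‖w‖ := by
    rw [hz, Lp.norm_toLp]
    exact ENNReal.toReal_le_of_le_ofReal hA0 hbound
  refine ⟨z, w - z, hzae, ?_, ?_⟩
  · obtain ⟨g, hg, -, heq⟩ := hu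
    refine ⟨g, hg, ?_, fun v h hv _ => ?_⟩
    · simp only [MemSqrtDomain, Real.sqrt_zero, Complex.ofReal_zero, zero_mul]
      exact MemLp.zero'
    -- Every `v` in `H¹` is admissible for `|V| - Δ`, so its equation can be tested with it and the
    -- potential term cancels against `⟨z, v⟩`.
    · rw [inner_sub_right, ← heq v h hv (hv.memSqrtDomain (by omega) hV), L2.inner_def v z]
      have e : ∫ x, inner ℂ (v x) (z x) =
          ∫ x, (‖V x‖ : ℂ) * u x * (starRingEnd ℂ) (v x) := by
        refine integral_congr_ae ?_
        filter_upwards [hzae] with x hx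
        rw [hx, RCLike.inner_apply]
      rw [e]
      simp
  · have : ‖w - z‖ ≤ ‖w‖ + ‖z‖ := norm_sub_le _ _
    linarith
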